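/- For $1<s\le 2$ let $T=T_s:[0,1]\to[0,1]$, $T_s(x)=\min\{sx,\,s(1-x)\}$, be the tent map with critical point $c=\tfrac12$ and $c_k=T^k(c)$, and let $$X'=\{(\dots,x_{-2},x_{-1},x_0): x_{-i}\in[c_2,c_1],\ T(x_{-i-1})=x_{-i}\text{ for all } i\ge 0\}$$ be its core inverse limit space, with the product topology. A continuum is a nonempty compact connected space. A point $x\in X'$ is an endpoint if for any two subcontinua $A,B\subset X'$ containing $x$, either $A\subset B$ or $B\subset A$; let $\mathcal E$ be the set of endpoints of $X'$. A point of $X'$ is a folding point if it has no neighbourhood in $X'$ homeomorphic to the product of a Cantor set and an open arc; let $\mathcal F$ be the set of folding points of $X'$. Let $\mathcal F_0\subset\mathcal F$ be the set of points of $X'$ that have no neighbourhood homeomorphic to the product of a compact zero-dimensional (compact, Hausdorff, totally disconnected) space and an open arc. Suppose that the orbit $\{T^n(c):n\ge 0\}$ is infinite and that $c$ is recurrent, i.e. $c\in\omega(c)$. Then $X'$ has uncountably many endpoints. Moreover, $\mathcal E$ has no isolated points, and $\mathcal E$ is dense in $\mathcal F_0$, that is, $\mathcal E\subset\mathcal F_0\subset\overline{\mathcal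 E}$. If $s>\sqrt2$, then $\mathcal E$ is dense in $\mathcal F$, that is, $\mathcal E\subset\mathcal F\subset\overline{\mathcal E}$. -/

import Mathlib

open Set Filter Topology

/-- The tent map `T_s(x) = min {s x, s (1 - x)}`. -/
noncomputable def tentMap (s x : ℝ) : ℝ := min (s * x) (s * (1 - x))

/-- The critical point `c = 1/2` of every tent map. -/
noncomputable def critPt : ℝ := 1 / 2

/-- The forward orbit `{x, f x, f² x, …}`. -/
def forwardOrbit {α : Type*} (f : α → α) (x : α) : Set α :=
  Set.range fun n : ℕ => f^[n] x

/-- `x` is recurrent if it belongs to its own omega-limit set. -/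
def IsRecurrentPt {α : Type*} [TopologicalSpace α] (f : α → α) (x : α) : Prop :=
  x ∈ omegaLimit atTop (fun (n : ℕ) (y : α) => f^[n] y) {x}

/-- The core `[c₂, c₁] = [T²(c), T(c)]`. -/
def tentCore (s : ℝ) : Set ℝ := Icc (tentMap s (tentMap s critPt)) (tentMap s critPt)

/-- The core inverse limit space: all backward orbits of `T_s` in the core. The entry `x i` is the
coordinate `π_i(x) = x_{-i}`. As a type it carries the subspace topology of the product topology on
`ℕ → ℝ`, which is the topology of the metric `∑ 2⁻ⁱ |x_{-i} - y_{-i}|`. -/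
def coreInverseLimit (s : ℝ) : Set (ℕ → ℝ) :=
  {x | ∀ i : ℕ, x i ∈ tentCore s ∧ tentMap s (x (i + 1)) = x i}

/-- A subcontinuum: a nonempty, compact, connected subset
(`IsConnected` includes nonemptiness). -/
def IsSubcontinuum {Y : Type*} [TopologicalSpace Y] (A : Set Y) : Prop :=
  IsCompact A ∧ IsConnected A

/-- The set of endpoints: points `x` such that any two subcontinua containing `x` are nested. -/
def endpoints (Y : Type*) [TopologicalSpace Y] : Set Y :=
  {x | ∀ A B : Set Y, IsSubcontinuum A → IsSubcontinuum B → x ∈ A → x ∈ B → A ⊆ B ∨ B ⊆ A}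

/-- The set of folding points: points without a neighbourhood homeomorphic to the product of the
Cantor set (here `ℕ → Bool`) and an open arc. -/
def foldingPoints (Y : Type*) [TopologicalSpace Y] : Set Y :=
  {x | ¬ ∃ U ∈ 𝓝 x, Nonempty (U ≃ₜ (ℕ → Bool) × Ioo (0 : ℝ) 1)}

/-- The variant of folding points in which the Cantor set may be replaced by any compact
zero-dimensional (i.e. compact Hausdorff totally disconnected) space: points without a
neighbourhood homeomorphic to the product of such a space and an open arc. (There is no loss in
taking `Z` in the universe of `Y`, because `Z` embeds in `Y`.) -/
def wideFoldingPoints.{u} (Y : Type u) [TopologicalSpace Y] : Set Y :=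
  {x | ¬ ∃ U ∈ 𝓝 x, ∃ (Z : Type u) (_ : TopologicalSpace Z),
    CompactSpace Z ∧ T2Space Z ∧ TotallyDisconnectedSpace Z ∧
      Nonempty (U ≃ₜ Z × Ioo (0 : ℝ) 1)}

/-! Let `K` be the closure of the critical orbit. Since `c` is recurrent with an infinite orbit,
`T` maps `K` onto itself and `K` is perfect, so the inverse limit of `T` on `K` is a compact perfect
space.

If `x_{-n}` is within `o(s⁻ⁿ)` of `c` for infinitely many `n`, then `x` is an endpoint. Indeed, for
points `a ∈ A \ B` and `b ∈ B \ A` of two continua through `x`, the level-`n` projections keep `a`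
away from `B`, and `b` away from `A`, by at least a constant times `s⁻ⁿ`. But whichever of `a` and
`b` has the larger projection lies in the projection of the other continuum, or else between that of
`x` and the maximum `T c`, which are too close. By recurrence this approximation property holds on a
residual subset of the inverse limit of `K`, which stays dense when a countable set is removed.

Along an interval that avoids the critical orbit the admissible itineraries do not change, so near
a point with some coordinate outside `K` the core inverse limit is the product of a closed set of
itineraries and an open arc. If `s > √2`, admissible itineraries branch infinitely often, so this
closed set is a Cantor set. Finally, no point of a product with an open arc is an endpoint. -/

section Recurrence

variable {X : Type*} [TopologicalSpace X] {f : X → X} {c z : X}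

/-- The orbit closure of `c`; when `c` is recurrent, this is its omega-limit set. -/
def orbitClosure (f : X → X) (c : X) : Set X := closure (forwardOrbit f c)

theorem iterate_mem_orbitClosure (f : X → X) (c : X) (n : ℕ) : f^[n] c ∈ orbitClosure f c :=
  subset_closure (mem_range_self n)

theorem mapsTo_orbitClosure (hf : Continuous f) :
    MapsTo f (orbitClosure f c) (orbitClosure f c) :=
  MapsTo.closure (by
    rintro _ ⟨n, rfl⟩
    exact ⟨n + 1, Function.iterate_succ_apply' f n c⟩) hf

theorem forwardOrbit_finite_of_iterate_eq {X : Type*} {f : X → X} {c : X} {m n : ℕ}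
    (hmn : m < n) (h : f^[m] c = f^[n] c) : (forwardOrbit f c).Finite := by
  have hper : Function.IsPeriodicPt f (n - m) (f^[m] c) := by
    rw [Function.IsPeriodicPt, Function.IsFixedPt, ← Function.iterate_add_apply,
      Nat.sub_add_cancel hmn.le, h]
  refine ((finite_Iio n).image fun k => f^[k] c).subset ?_
  rintro _ ⟨k, rfl⟩
  rcases lt_or_ge k n with hk | hk
  · exact ⟨k, hk, rfl⟩
  · refine ⟨(k - m) % (n - m) + m, ?_, ?_⟩
    · have := Nat.mod_lt (k - m) (Nat.sub_pos_of_lt hmn)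
      simp only [mem_Iio]
      omega
    · simp only [Function.iterate_add_apply, hper.iterate_mod_apply]
      rw [← Function.iterate_add_apply, Nat.sub_add_cancel (hmn.le.trans hk)]

theorem IsRecurrentPt.mapClusterPt (h : IsRecurrentPt f c) (hf : Continuous f)
    (hz : z ∈ orbitClosure f c) : MapClusterPt z atTop (f^[·] c) := by
  have hsub : orbitClosure f c ⊆ omegaLimit atTop (fun (n : ℕ) (y : X) => f^[n] y) {c} := by
    refine closure_minimal ?_ (isClosed_omegaLimit ..)
    rintro _ ⟨k, rfl⟩
    rw [mem_omegaLimit_singleton_iff_mapClusterPt]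
    have hc := (mem_omegaLimit_singleton_iff_mapClusterPt ..).1 h
    have hk := hc.continuousAt_comp (hf.iterate k).continuousAt
    refine .of_comp (φ := (k + ·)) (tendsto_atTop_mono (Nat.le_add_left · k) tendsto_id) ?_
    simpa only [Function.comp_def, Function.iterate_add_apply] using hk
  exact (mem_omegaLimit_singleton_iff_mapClusterPt ..).1 (hsub hz)

theorem IsRecurrentPt.surjOn_orbitClosure [T2Space X] (h : IsRecurrentPt f c) (hf : Continuous f)
    (hc : IsCompact (orbitClosure f c)) : SurjOn f (orbitClosure f c) (orbitClosure f c) := by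
  intro z hz
  have hz' := mapClusterPt_atTop_iff_forall_mem_closure.1 (h.mapClusterPt hf hz) 1
  refine closure_minimal ?_ (hc.image hf).isClosed hz'
  rintro _ ⟨n, hn, rfl⟩
  obtain ⟨m, rfl⟩ := Nat.exists_eq_add_of_le' hn
  exact ⟨f^[m] c, iterate_mem_orbitClosure f c m, (Function.iterate_succ_apply' f m c).symm⟩

theorem IsRecurrentPt.preperfect_orbitClosure (h : IsRecurrentPt f c) (hf : Continuous f)
    (hinf : (forwardOrbit f c).Infinite) : Preperfect (orbitClosure f c) := by
  rw [preperfect_iff_nhds]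
  intro z hz U hU
  by_contra! hsub
  have hfreq : ∃ᶠ n in atTop, f^[n] c = z :=
    ((h.mapClusterPt hf hz).frequently hU).mono fun n hn =>
      hsub _ ⟨hn, iterate_mem_orbitClosure f c n⟩
  obtain ⟨m, hm⟩ := hfreq.exists
  obtain ⟨n, hn, hnz⟩ := (frequently_atTop.1 hfreq) (m + 1)
  exact hinf (forwardOrbit_finite_of_iterate_eq hn (hm.trans hnz.symm))

end Recurrence

/-- The inverse limit of `f` restricted to `K`: the backward orbits of `f` in `K`, with the present
at index `0`. -/
def backwardOrbits {X : Type*} (f : X → X) (K : Set X) : Set (ℕ → X) :=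
  {b | ∀ i, b i ∈ K ∧ f (b (i + 1)) = b i}

namespace backwardOrbits

variable {X : Type*} {f : X → X} {K : Set X} {b : ℕ → X}

theorem iterate_apply_add (hb : b ∈ backwardOrbits f K) (n k : ℕ) : f^[n] (b (n + k)) = b k := by
  induction n with
  | zero => simp
  | succ n ih => rw [Function.iterate_succ_apply, Nat.succ_add, (hb _).2, ih]

theorem iterate_sub_apply (hb : b ∈ backwardOrbits f K) {j n : ℕ} (h : j ≤ n) :
    f^[n - j] (b n) = b j := by
  simpa only [Nat.sub_add_cancel h] using iterate_apply_add hb (n - j) j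

theorem mono {L : Set X} (h : K ⊆ L) : backwardOrbits f K ⊆ backwardOrbits f L :=
  fun _ hb i => ⟨h (hb i).1, (hb i).2⟩

theorem iterate_comp_mem (hK : MapsTo f K K) (hb : b ∈ backwardOrbits f K) (n : ℕ) :
    f^[n] ∘ b ∈ backwardOrbits f K := fun i =>
  ⟨hK.iterate n (hb i).1, by
    rw [Function.comp_apply, ← Function.iterate_succ_apply' f, Function.iterate_succ_apply,
      (hb i).2, Function.comp_apply]⟩

theorem exists_apply_eq (hK : MapsTo f K K) (hsurj : SurjOn f K K) {z : X} (hz : z ∈ K) (n : ℕ) :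
    ∃ x : backwardOrbits f K, x.1 n = z := by
  have : Nonempty X := ⟨z⟩
  have hb : (fun i => (Function.invFunOn f K)^[i] z) ∈ backwardOrbits f K := fun i => by
    have hi := hsurj.mapsTo_invFunOn.iterate i hz
    refine ⟨hi, ?_⟩
    simp only [Function.iterate_succ_apply', hsurj.rightInvOn_invFunOn hi]
  exact ⟨⟨_, iterate_comp_mem hK hb n⟩, iterate_apply_add hb n 0⟩

variable [TopologicalSpace X]

theorem continuous_apply (n : ℕ) : Continuous fun x : backwardOrbits f K => x.1 n :=
  (_root_.continuous_apply n).comp continuous_subtype_val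

/-- The `n`-fold shift of the inverse limit, which discards the `n` latest entries; its inverse
applies `f^[n]` to every entry. -/
def shift (hf : Continuous f) (hK : MapsTo f K K) (n : ℕ) :
    backwardOrbits f K ≃ₜ backwardOrbits f K where
  toFun x := ⟨fun k => x.1 (n + k), fun k => x.2 (n + k)⟩
  invFun x := ⟨f^[n] ∘ x.1, iterate_comp_mem hK x.2 n⟩
  left_inv x := Subtype.ext (funext fun k => iterate_apply_add x.2 n k)
  right_inv x := Subtype.ext (funext fun k => iterate_apply_add x.2 n k)
  continuous_toFun := (continuous_pi fun k => continuous_apply (n + k)).subtype_mk _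
  continuous_invFun :=
    (continuous_pi fun k => (hf.iterate n).comp (continuous_apply k)).subtype_mk _

theorem exists_nhds_apply_subset (hf : Continuous f) {x : backwardOrbits f K}
    {U : Set (backwardOrbits f K)} (hU : U ∈ 𝓝 x) :
    ∃ n, ∃ V ∈ 𝓝 (x.1 n), ∀ y : backwardOrbits f K, y.1 n ∈ V → y ∈ U := by
  obtain ⟨W, hW, hWU⟩ := mem_nhds_subtype _ _ _ |>.1 hU
  rw [nhds_pi, Filter.mem_pi'] at hW
  obtain ⟨I, t, ht, htW⟩ := hW
  obtain ⟨n, hn⟩ := I.exists_le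
  refine ⟨n, ⋂ i ∈ I, f^[n - i] ⁻¹' t i, ?_, fun y hy => hWU (htW fun i hi => ?_)⟩
  · refine (biInter_finset_mem I).2 fun i hi => (hf.iterate _).continuousAt.preimage_mem_nhds ?_
    rw [iterate_sub_apply x.2 (hn i hi)]
    exact ht i
  · rw [← iterate_sub_apply y.2 (hn i hi)]
    exact mem_iInter₂.1 hy i hi

theorem isCompact [T2Space X] (hf : Continuous f) (hK : IsCompact K) :
    IsCompact (backwardOrbits f K) := by
  have hclosed : IsClosed {b : ℕ → X | ∀ i, f (b (i + 1)) = b i} := by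
    simp only [ofPred_forall]
    exact isClosed_iInter fun i => isClosed_eq (by fun_prop) (by fun_prop)
  convert (isCompact_univ_pi fun _ => hK).inter_right hclosed using 1
  ext b
  simp [backwardOrbits, forall_and]

theorem perfectSpace (hf : Continuous f) (hK : Preperfect K) (hmaps : MapsTo f K K)
    (hsurj : SurjOn f K K) : PerfectSpace (backwardOrbits f K) := by
  refine ⟨preperfect_iff_nhds.2 fun x _ U hU => ?_⟩
  obtain ⟨n, V, hV, hVU⟩ := exists_nhds_apply_subset hf hU
  obtain ⟨z, ⟨hzV, hzK⟩, hzx⟩ := preperfect_iff_nhds.1 hK _ (x.2 n).1 V hV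
  obtain ⟨y, rfl⟩ := exists_apply_eq hmaps hsurj hzK n
  exact ⟨y, ⟨hVU y hzV, mem_univ y⟩, fun h => hzx (by rw [h])⟩

end backwardOrbits

section Residual

variable {X : Type*} [TopologicalSpace X] {f : X → X} {c : X}

theorem IsRecurrentPt.eventually_residual_frequently_mem [T2Space X] (h : IsRecurrentPt f c)
    (hf : Continuous f) (hc : IsCompact (orbitClosure f c)) {V : ℕ → Set X} (hV : ∀ n, V n ∈ 𝓝 c) :
    ∀ᶠ x in residual (backwardOrbits f (orbitClosure f c)), ∃ᶠ n in atTop, x.1 n ∈ V n := by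
  simp only [frequently_atTop]
  rw [eventually_countable_forall]
  intro N
  have hopen : IsOpen {x : backwardOrbits f (orbitClosure f c) |
      ∃ n ≥ N, x.1 n ∈ interior (V n)} := by
    simp only [ofPred_exists, ofPred_and]
    exact isOpen_iUnion fun n => isOpen_const.inter
      (isOpen_interior.preimage (backwardOrbits.continuous_apply n))
  refine mem_of_superset (residual_of_dense_open hopen ?_)
    fun x ⟨n, hn, hx⟩ => ⟨n, hn, interior_subset hx⟩
  intro x
  rw [mem_closure_iff_nhds]
  intro U hU
  obtain ⟨k, W, hW, hWU⟩ := backwardOrbits.exists_nhds_apply_subset hf hU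
  -- A lift of `c` to a deep level `k + m` is near `x` at level `k` once `f^m c` is near `x k`.
  obtain ⟨m, hm, hmW⟩ := (frequently_atTop.1 ((h.mapClusterPt hf (x.2 k).1).frequently hW)) N
  obtain ⟨y, hy⟩ := backwardOrbits.exists_apply_eq (mapsTo_orbitClosure hf)
    (h.surjOn_orbitClosure hf hc) (iterate_mem_orbitClosure f c 0) (m + k)
  refine ⟨y, hWU y ?_, m + k, le_add_right hm, ?_⟩
  · rw [← backwardOrbits.iterate_apply_add y.2 m k, hy]
    exact hmW
  · rw [hy]
    exact mem_interior_iff_mem_nhds.2 (hV _)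

theorem compl_mem_residual_of_countable [T1Space X] [PerfectSpace X] {C : Set X}
    (hC : C.Countable) : Cᶜ ∈ residual X := by
  rw [← biUnion_of_singleton C, compl_iUnion₂]
  exact (countable_bInter_mem hC).2 fun x _ =>
    residual_of_dense_open isOpen_compl_singleton (dense_compl_singleton x)

end Residual

section Endpoints

open scoped NNReal

theorem exists_forall_le_pow_mul_dist {X : Type*} [PseudoMetricSpace X] {f : X → X} {K : Set X}
    {L : ℝ≥0} (hf : LipschitzWith L f) (hL : 1 ≤ L) {a : backwardOrbits f K}
    {B : Set (backwardOrbits f K)} (hB : IsClosed B) (ha : a ∉ B) :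
    ∃ ε > 0, ∀ᶠ n in atTop, ∀ b ∈ B, ε ≤ (L : ℝ) ^ n * dist (a.1 n) (b.1 n) := by
  obtain ⟨N, V, hV, hVB⟩ :=
    backwardOrbits.exists_nhds_apply_subset hf.continuous (hB.isOpen_compl.mem_nhds ha)
  obtain ⟨ε, hε, hball⟩ := Metric.mem_nhds_iff.1 hV
  refine ⟨ε, hε, (eventually_ge_atTop N).mono fun n hn b hb => ?_⟩
  have hfar : ε ≤ dist (a.1 N) (b.1 N) := by
    by_contra! h
    exact hVB b (hball (by rwa [Metric.mem_ball, dist_comm])) hb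
  calc ε ≤ dist (f^[n - N] (a.1 n)) (f^[n - N] (b.1 n)) := by
        rwa [backwardOrbits.iterate_sub_apply a.2 hn, backwardOrbits.iterate_sub_apply b.2 hn]
    _ ≤ (L ^ (n - N) : ℝ≥0) * dist (a.1 n) (b.1 n) := (hf.iterate _).dist_le_mul _ _
    _ ≤ (L : ℝ) ^ n * dist (a.1 n) (b.1 n) := by
        push_cast
        gcongr
        exact Nat.sub_le n N

variable {f : ℝ → ℝ} {c : ℝ} {L : ℝ≥0} {K : Set ℝ}

theorem exists_dist_apply_le (hf : LipschitzWith L f) (hmax : ∀ t, f t ≤ f c)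
    {A : Set (backwardOrbits f K)} (hA : IsPreconnected A) {x a b : backwardOrbits f K}
    (hx : x ∈ A) (ha : a ∈ A) {n : ℕ} (hab : a.1 n ≤ b.1 n) :
    ∃ a' ∈ A, dist (b.1 n) (a'.1 n) ≤ L * dist (x.1 (n + 1)) c := by
  rcases le_total (b.1 n) (x.1 n) with h | h
  · have hord := (hA.image (fun y => y.1 n)
      (backwardOrbits.continuous_apply n).continuousOn).ordConnected
    obtain ⟨a', ha', hba⟩ := hord.out (mem_image_of_mem _ ha) (mem_image_of_mem _ hx) ⟨hab, h⟩
    exact ⟨a', ha', by simp only [hba, dist_self]; positivity⟩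
  · refine ⟨x, hx, ?_⟩
    calc dist (b.1 n) (x.1 n) = f (b.1 (n + 1)) - f (x.1 (n + 1)) := by
          rw [(b.2 n).2, (x.2 n).2, Real.dist_eq, abs_of_nonneg (sub_nonneg.2 h)]
      _ ≤ f c - f (x.1 (n + 1)) := sub_le_sub_right (hmax _) _
      _ ≤ dist (f (x.1 (n + 1))) (f c) := by
          rw [dist_comm]
          exact le_abs_self _
      _ ≤ L * dist (x.1 (n + 1)) c := hf.dist_le_mul _ _

theorem mem_endpoints_of_frequently (hf : LipschitzWith L f) (hL : 1 ≤ L) (hmax : ∀ t, f t ≤ f c)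
    {x : backwardOrbits f K} (h : ∀ ε > 0, ∃ᶠ n in atTop, (L : ℝ) ^ n * dist (x.1 n) c < ε) :
    x ∈ endpoints (backwardOrbits f K) := by
  intro A B hA hB hxA hxB
  by_contra! hne
  obtain ⟨a, haA, haB⟩ := not_subset.1 hne.1
  obtain ⟨b, hbB, hbA⟩ := not_subset.1 hne.2
  obtain ⟨ε, hε, hεB⟩ := exists_forall_le_pow_mul_dist hf hL hB.1.isClosed haB
  obtain ⟨δ, hδ, hδA⟩ := exists_forall_le_pow_mul_dist hf hL hA.1.isClosed hbA
  obtain ⟨N, hN⟩ := eventually_atTop.1 (hεB.and hδA)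
  obtain ⟨m, hm, hmc⟩ := frequently_atTop.1 (h (min ε δ) (lt_min hε hδ)) (N + 1)
  obtain ⟨n, rfl⟩ := Nat.exists_eq_add_of_le' (Nat.le_of_add_left_le hm)
  obtain ⟨hεn, hδn⟩ := hN n (Nat.le_of_succ_le_succ hm)
  have hscale {r : ℝ} (hr : r ≤ L * dist (x.1 (n + 1)) c) : (L : ℝ) ^ n * r < min ε δ := by
    refine lt_of_le_of_lt ?_ hmc
    rw [pow_succ, mul_assoc]
    gcongr
  rcases le_total (a.1 n) (b.1 n) with hab | hba
  · obtain ⟨a', ha', hd⟩ := exists_dist_apply_le hf hmax hA.2.isPreconnected hxA haA hab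
    exact ((hδn a' ha').trans_lt (hscale hd)).not_ge (min_le_right ε δ)
  · obtain ⟨b', hb', hd⟩ := exists_dist_apply_le hf hmax hB.2.isPreconnected hxB hbB hba
    exact ((hεn b' hb').trans_lt (hscale hd)).not_ge (min_le_left ε δ)

theorem IsRecurrentPt.mem_closure_endpoints_diff (hrec : IsRecurrentPt f c)
    (hinf : (forwardOrbit f c).Infinite) (hf : LipschitzWith L f) (hL : 1 ≤ L)
    (hmax : ∀ t, f t ≤ f c) (hc : IsCompact (orbitClosure f c)) (hcK : orbitClosure f c ⊆ K)
    {C : Set (backwardOrbits f K)} (hC : C.Countable) {x : backwardOrbits f K}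
    (hx : ∀ n, x.1 n ∈ orbitClosure f c) : x ∈ closure (endpoints (backwardOrbits f K) \ C) := by
  have hmaps := mapsTo_orbitClosure (c := c) hf.continuous
  have := backwardOrbits.perfectSpace hf.continuous
    (hrec.preperfect_orbitClosure hf.continuous hinf) hmaps
    (hrec.surjOn_orbitClosure hf.continuous hc)
  have := isCompact_iff_compactSpace.1 (backwardOrbits.isCompact hf.continuous hc)
  let ι : backwardOrbits f (orbitClosure f c) → backwardOrbits f K :=
    inclusion (backwardOrbits.mono hcK)
  have hV (n : ℕ) : {t | (L : ℝ) ^ n * dist t c < 1 / (n + 1)} ∈ 𝓝 c := by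
    have hcont : ContinuousAt (fun t => (L : ℝ) ^ n * dist t c) c := by fun_prop
    refine hcont.eventually_lt continuousAt_const ?_
    simp only [dist_self, mul_zero]
    positivity
  have hres : ∀ᶠ y in residual (backwardOrbits f (orbitClosure f c)),
      ι y ∈ endpoints (backwardOrbits f K) \ C := by
    filter_upwards [hrec.eventually_residual_frequently_mem hf.continuous hc hV,
      compl_mem_residual_of_countable (hC.preimage (inclusion_injective _))] with y hy hyC
    refine ⟨mem_endpoints_of_frequently hf hL hmax fun ε hε => ?_, hyC⟩
    have hlt := (tendsto_one_div_add_atTop_nhds_zero_nat (𝕜 := ℝ)).eventually_lt_const hε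
    exact (hy.and_eventually hlt).mono fun n hn => hn.1.trans hn.2
  exact map_mem_closure (f := ι) (continuous_inclusion _) (dense_of_mem_residual hres
    ⟨x.1, fun n => ⟨hx n, (x.2 n).2⟩⟩) fun y hy => hy

end Endpoints

section Arcs

theorem endpoints_eq_empty (α : Type*) [ConditionallyCompleteLinearOrder α] [TopologicalSpace α]
    [OrderTopology α] [DenselyOrdered α] [NoMinOrder α] [NoMaxOrder α] :
    endpoints α = ∅ := by
  refine eq_empty_of_forall_notMem fun t ht => ?_
  obtain ⟨a, hat⟩ := exists_lt t
  obtain ⟨b, htb⟩ := exists_gt t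
  rcases ht _ _ ⟨isCompact_Icc, isConnected_Icc hat.le⟩ ⟨isCompact_Icc, isConnected_Icc htb.le⟩
    (right_mem_Icc.2 hat.le) (left_mem_Icc.2 htb.le) with h | h
  · exact hat.not_ge (h (left_mem_Icc.2 hat.le)).1
  · exact htb.not_ge (h (right_mem_Icc.2 htb.le)).2

theorem endpoints_Ioo_eq_empty {a b : ℝ} : endpoints (Ioo a b) = ∅ := by
  refine eq_empty_of_forall_notMem fun t ht => ?_
  have : Inhabited (Ioo a b) := ⟨t⟩
  exact (endpoints_eq_empty (Ioo a b)).subset ht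

variable {Y Z : Type*} [TopologicalSpace Y] [TopologicalSpace Z]

theorem mem_endpoints_of_injective {γ : Z → Y} (hγ : Continuous γ) (hinj : γ.Injective) {z : Z}
    (hz : γ z ∈ endpoints Y) : z ∈ endpoints Z := by
  intro A B hA hB hzA hzB
  have himage {S : Set Z} (hS : IsSubcontinuum S) : IsSubcontinuum (γ '' S) :=
    ⟨hS.1.image hγ, hS.2.image γ hγ.continuousOn⟩
  simpa only [image_subset_image_iff hinj] using hz _ _ (himage hA) (himage hB)
    (mem_image_of_mem γ hzA) (mem_image_of_mem γ hzB)

theorem endpoints_subset_wideFoldingPoints : endpoints Y ⊆ wideFoldingPoints Y := by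
  rintro x hx ⟨U, hU, Z, _, -, -, -, ⟨φ⟩⟩
  let p := φ ⟨x, mem_of_mem_nhds hU⟩
  have hγ : (φ.symm (p.1, p.2)).1 ∈ endpoints Y := by simpa [p] using hx
  have ht := mem_endpoints_of_injective (γ := fun t => (φ.symm (p.1, t)).1) (by fun_prop)
    (Subtype.val_injective.comp (φ.symm.injective.comp (Prod.mk_right_injective p.1))) hγ
  exact endpoints_Ioo_eq_empty.subset ht

theorem wideFoldingPoints_subset_foldingPoints :
    wideFoldingPoints Y ⊆ foldingPoints Y := by
  rintro x hx ⟨U, hU, ⟨φ⟩⟩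
  exact hx ⟨U, hU, ULift (ℕ → Bool), inferInstance, inferInstance, inferInstance,
    Homeomorph.ulift.symm.totallyDisconnectedSpace,
    ⟨φ.trans (Homeomorph.ulift.symm.prodCongr (.refl _))⟩⟩

theorem nonempty_homeomorph_Ioo {a b : ℝ} (h : a < b) : Nonempty (Ioo a b ≃ₜ Ioo (0 : ℝ) 1) := by
  let e := affineHomeomorph (b - a) a (sub_pos.2 h).ne'
  have he : e '' Ioo 0 1 = Ioo a b := by
    rw [affineHomeomorph_image_Ioo _ _ _ _ (sub_pos.2 h)]
    simp
  exact ⟨((e.image _).trans (Homeomorph.setCongr he)).symm⟩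

end Arcs

section Cantor

open PiNat

/-- The elements of `S` that agree with `e` before `k` can take either value at `k`. -/
def Splits (S : Set (ℕ → Bool)) (e : ℕ → Bool) (k : ℕ) : Prop :=
  ∀ b, ∃ e' ∈ S ∩ cylinder e k, e' k = b

/-- The coding of the elements of a perfect set of binary sequences by arbitrary binary sequences:
only the letters at the splitting places are recorded. -/
noncomputable def splitLetters (S : Set (ℕ → Bool)) (e : ℕ → Bool) (j : ℕ) : Bool :=
  e (Nat.nth (Splits S e) j)

variable {S : Set (ℕ → Bool)} {e e' : ℕ → Bool}

theorem splits_iff_of_mem_cylinder {k n : ℕ} (he : e' ∈ cylinder e n) (hk : k ≤ n) :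
    Splits S e' k ↔ Splits S e k := by
  rw [Splits, Splits, mem_cylinder_iff_eq.1 (cylinder_anti e hk he)]

theorem splits_firstDiff (he : e ∈ S) (he' : e' ∈ S) (hne : e ≠ e') :
    Splits S e (firstDiff e e') := by
  have hdiff := apply_firstDiff_ne hne
  intro b
  by_cases hb : e (firstDiff e e') = b
  · exact ⟨e, ⟨he, self_mem_cylinder e _⟩, hb⟩
  · refine ⟨e', ⟨he', firstDiff_comm e e' ▸ mem_cylinder_firstDiff e' e⟩, ?_⟩
    exact (Bool.eq_not_of_ne hdiff.symm).trans (Bool.eq_not_of_ne (Ne.symm hb)).symm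

theorem infinite_splits (hS : Preperfect S) (he : e ∈ S) : {k | Splits S e k}.Infinite := by
  rw [← Nat.frequently_atTop_iff_infinite, frequently_atTop]
  intro n
  obtain ⟨e', ⟨hn, he'⟩, hne⟩ := preperfect_iff_nhds.1 hS e he (cylinder e n)
    ((isOpen_cylinder _ e n).mem_nhds (self_mem_cylinder e n))
  refine ⟨firstDiff e e', ?_, splits_firstDiff he he' hne.symm⟩
  by_contra! h
  exact apply_firstDiff_ne hne.symm (hn _ h).symm

open Classical in
theorem splitLetters_count {k : ℕ} (hk : Splits S e k) (he : e' ∈ cylinder e k) :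
    splitLetters S e' (Nat.count (Splits S e) k) = e' k := by
  have hcount : Nat.count (Splits S e') k = Nat.count (Splits S e) k := by
    simp only [Nat.count_eq_card_filter_range]
    exact congrArg Finset.card (Finset.filter_congr fun i hi =>
      splits_iff_of_mem_cylinder he (Finset.mem_range.1 hi).le)
  rw [splitLetters, ← hcount, Nat.nth_count ((splits_iff_of_mem_cylinder he le_rfl).2 hk)]

theorem splitLetters_eq_apply_nth (h : {k | Splits S e k}.Infinite) {j : ℕ}
    (he : e' ∈ cylinder e (Nat.nth (Splits S e) j)) :
    splitLetters S e' j = e' (Nat.nth (Splits S e) j) := by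
  classical
  simpa only [Nat.count_nth_of_infinite h] using
    splitLetters_count (Nat.nth_mem_of_infinite h j) he

theorem continuousOn_splitLetters (hS : Preperfect S) : ContinuousOn (splitLetters S) S := by
  refine continuousOn_pi.2 fun j e he => ContinuousAt.continuousWithinAt ?_
  have h := infinite_splits hS he
  refine (continuousAt_const (y := splitLetters S e j)).congr ?_
  filter_upwards [(isOpen_cylinder _ e (Nat.nth (Splits S e) j + 1)).mem_nhds
    (self_mem_cylinder e _)] with e' he'
  rw [splitLetters_eq_apply_nth h (cylinder_anti e (Nat.le_succ _) he'), splitLetters]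
  exact (he' _ (Nat.lt_succ_self _)).symm

theorem injOn_splitLetters : InjOn (splitLetters S) S := by
  classical
  intro e he e' he' heq
  by_contra hne
  have hk := splits_firstDiff he he' hne
  have hcyl : e' ∈ cylinder e (firstDiff e e') := firstDiff_comm e e' ▸ mem_cylinder_firstDiff e' e
  apply apply_firstDiff_ne hne
  rw [← splitLetters_count hk (self_mem_cylinder e _), heq, splitLetters_count hk hcyl]

theorem exists_splitLetters_mem_cylinder (hS : Preperfect S) (hne : S.Nonempty) (a : ℕ → Bool)
    (n : ℕ) : ∃ e ∈ S, splitLetters S e ∈ cylinder a n := by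
  induction n with
  | zero => exact hne.imp fun e he => ⟨he, by simp only [cylinder_zero, mem_univ]⟩
  | succ n ih =>
    obtain ⟨e, he, hen⟩ := ih
    have h := infinite_splits hS he
    obtain ⟨e', ⟨he', hcyl⟩, hb⟩ := Nat.nth_mem_of_infinite h n (a n)
    refine ⟨e', he', fun j hj => ?_⟩
    have hjn := Nat.lt_succ_iff.1 hj
    rw [splitLetters_eq_apply_nth h (cylinder_anti e (Nat.nth_monotone h hjn) hcyl)]
    rcases hjn.eq_or_lt with rfl | hlt
    · exact hb
    · exact (hcyl _ (Nat.nth_strictMono h hlt)).trans (hen j hlt)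

theorem surjOn_splitLetters (hS : Perfect S) (hne : S.Nonempty) :
    SurjOn (splitLetters S) S univ := by
  intro a _
  have hcompact := hS.closed.isCompact.image_of_continuousOn (continuousOn_splitLetters hS.acc)
  rw [← hcompact.isClosed.closure_eq, (isTopologicalBasis_cylinders _).mem_closure_iff]
  rintro _ ⟨e, n, rfl⟩ ha
  obtain ⟨e', he', hn⟩ := exists_splitLetters_mem_cylinder hS.acc hne a n
  exact ⟨_, mem_cylinder_iff_eq.1 ha ▸ hn, mem_image_of_mem _ he'⟩

theorem nonempty_homeomorph_nat_bool_of_perfect (hS : Perfect S) (hne : S.Nonempty) :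
    Nonempty (S ≃ₜ (ℕ → Bool)) := by
  have := isCompact_iff_compactSpace.1 hS.closed.isCompact
  have hhomeo : IsHomeomorph (S.domRestrict (splitLetters S)) :=
    isHomeomorph_iff_continuous_bijective.2
      ⟨(continuousOn_splitLetters hS.acc).domRestrict, injOn_splitLetters.injective,
        surjOn_iff_surjective.1 (surjOn_splitLetters hS hne)⟩
  exact ⟨hhomeo.homeomorph⟩

end Cantor

section Tent

variable {s x y : ℝ}

theorem continuous_tentMap (s : ℝ) : Continuous (tentMap s) := by
  unfold tentMap
  fun_prop

theorem tentMap_of_le (hs : 0 ≤ s) (hx : x ≤ critPt) : tentMap s x = s * x := by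
  rw [critPt] at hx
  exact min_eq_left (by nlinarith)

theorem tentMap_of_ge (hs : 0 ≤ s) (hx : critPt ≤ x) : tentMap s x = s * (1 - x) := by
  rw [critPt] at hx
  exact min_eq_right (by nlinarith)

theorem tentMap_eq (hs : 0 ≤ s) (x : ℝ) : tentMap s x = s / 2 - s * |x - critPt| := by
  rcases le_total x critPt with h | h
  · rw [tentMap_of_le hs h, abs_of_nonpos (by linarith), critPt]
    ring
  · rw [tentMap_of_ge hs h, abs_of_nonneg (by linarith), critPt]
    ring

theorem tentMap_critPt (hs : 0 ≤ s) : tentMap s critPt = s / 2 := by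
  simp [tentMap_eq hs]

theorem tentMap_le_tentMap_critPt (hs : 0 ≤ s) (x : ℝ) : tentMap s x ≤ tentMap s critPt := by
  rw [tentMap_critPt hs, tentMap_eq hs]
  exact sub_le_self _ (by positivity)

theorem lipschitzWith_tentMap (hs : 0 ≤ s) : LipschitzWith s.toNNReal (tentMap s) :=
  LipschitzWith.of_dist_le' fun x y => by
    calc dist (tentMap s x) (tentMap s y) = s * |(|y - critPt| - |x - critPt|)| := by
          rw [Real.dist_eq, tentMap_eq hs, tentMap_eq hs, sub_sub_sub_cancel_left, ← mul_sub,
            abs_mul, abs_of_nonneg hs]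
      _ ≤ s * |(y - critPt) - (x - critPt)| :=
          mul_le_mul_of_nonneg_left (abs_abs_sub_abs_le _ _) hs
      _ = s * dist x y := by rw [sub_sub_sub_cancel_right, dist_comm, Real.dist_eq]

theorem tentCore_eq (hs : 1 ≤ s) : tentCore s = Icc (s * (1 - s / 2)) (s / 2) := by
  rw [tentCore, tentMap_critPt (by linarith),
    tentMap_of_ge (by linarith) (by rw [critPt]; linarith)]

theorem critPt_mem_tentCore (hs : 1 ≤ s) : critPt ∈ tentCore s := by
  rw [tentCore_eq hs, critPt]
  constructor <;> nlinarith [sq_nonneg (s - 1)]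

theorem mapsTo_tentMap_tentCore (hs₁ : 1 ≤ s) (hs₂ : s ≤ 2) :
    MapsTo (tentMap s) (tentCore s) (tentCore s) := by
  intro x hx
  refine ⟨?_, tentMap_le_tentMap_critPt (by linarith) x⟩
  rw [tentMap_critPt (by linarith), tentMap_of_ge (by linarith) (by rw [critPt]; linarith)]
  rw [tentCore_eq hs₁] at hx
  rcases le_total x critPt with h | h
  · rw [tentMap_of_le (by linarith) h]
    have : 1 - s / 2 ≤ x := (le_mul_of_one_le_left (by linarith) hs₁).trans hx.1
    gcongr
  · rw [tentMap_of_ge (by linarith) h]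
    have := hx.2
    gcongr

theorem orbitClosure_subset_tentCore (hs₁ : 1 ≤ s) (hs₂ : s ≤ 2) :
    orbitClosure (tentMap s) critPt ⊆ tentCore s := by
  refine closure_minimal ?_ isClosed_Icc
  rintro _ ⟨n, rfl⟩
  exact (mapsTo_tentMap_tentCore hs₁ hs₂).iterate n (critPt_mem_tentCore hs₁)

theorem isCompact_orbitClosure_tentMap (hs₁ : 1 ≤ s) (hs₂ : s ≤ 2) :
    IsCompact (orbitClosure (tentMap s) critPt) :=
  isCompact_Icc.of_isClosed_subset isClosed_closure (orbitClosure_subset_tentCore hs₁ hs₂)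

theorem iterate_three_critPt (hs : 1 ≤ s) : (tentMap s)^[3] critPt = s * (s * (1 - s / 2)) := by
  have hc : s * (1 - s / 2) ≤ critPt := by
    have hmem := critPt_mem_tentCore hs
    rw [tentCore_eq hs] at hmem
    exact hmem.1
  have hs₂ : critPt ≤ s / 2 := by
    rw [critPt]
    linarith
  simp only [Function.iterate_succ_apply, Function.iterate_zero_apply]
  rw [tentMap_critPt (by linarith), tentMap_of_ge (by linarith) hs₂,
    tentMap_of_le (by linarith) hc]

theorem mem_closure_endpoints_coreInverseLimit_diff (hs₁ : 1 ≤ s) (hs₂ : s ≤ 2)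
    (hinf : (forwardOrbit (tentMap s) critPt).Infinite) (hrec : IsRecurrentPt (tentMap s) critPt)
    {C : Set (coreInverseLimit s)} (hC : C.Countable) {x : coreInverseLimit s}
    (hx : ∀ n, x.1 n ∈ orbitClosure (tentMap s) critPt) :
    x ∈ closure (endpoints (coreInverseLimit s) \ C) :=
  hrec.mem_closure_endpoints_diff hinf (lipschitzWith_tentMap (by linarith))
    (Real.one_le_toNNReal.2 hs₁) (tentMap_le_tentMap_critPt (by linarith))
    (isCompact_orbitClosure_tentMap hs₁ hs₂) (orbitClosure_subset_tentCore hs₁ hs₂) hC hx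

end Tent

section Itineraries

variable {s y : ℝ} {e : ℕ → Bool} {x : ℕ → ℝ}

/-- The inverse branches of the tent map: the left one for `true`, the right one for `false`. -/
noncomputable def inverseBranch (s : ℝ) : Bool → ℝ → ℝ
  | true, y => y / s
  | false, y => 1 - y / s

/-- The backward path of `y` that follows the inverse branches prescribed by `e`. -/
noncomputable def branchPath (s : ℝ) (e : ℕ → Bool) (y : ℝ) : ℕ → ℝ
  | 0 => y
  | k + 1 => inverseBranch s (e k) (branchPath s e y k)

/-- The sequences of inverse branches along which the backward path of `y` stays in the core. -/
def admissibleItineraries (s y : ℝ) : Set (ℕ → Bool) := {e | ∀ k, branchPath s e y k ∈ tentCore s}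

/-- The sequence of inverse branches that a backward orbit takes; a passage through the critical
point is coded as the right branch. -/
noncomputable def itinerary (x : ℕ → ℝ) (k : ℕ) : Bool := decide (x (k + 1) < critPt)

theorem inverseBranch_tentMap (hs : 0 < s) (t : ℝ) :
    inverseBranch s (decide (t < critPt)) (tentMap s t) = t := by
  by_cases h : t < critPt
  · rw [decide_eq_true h, inverseBranch, tentMap_of_le hs.le h.le, mul_div_cancel_left₀ _ hs.ne']
  · rw [decide_eq_false h, inverseBranch, tentMap_of_ge hs.le (not_lt.1 h),
      mul_div_cancel_left₀ _ hs.ne', sub_sub_cancel]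

theorem div_le_critPt (hs : 0 < s) (hy : y ≤ s / 2) : y / s ≤ critPt := by
  rw [div_le_iff₀ hs, critPt]
  linarith

theorem tentMap_inverseBranch (hs : 0 < s) (hy : y ≤ s / 2) (b : Bool) :
    tentMap s (inverseBranch s b y) = y := by
  have h := div_le_critPt hs hy
  cases b
  · have h' : critPt ≤ 1 - y / s := by
      rw [critPt] at *
      linarith
    rw [inverseBranch, tentMap_of_ge hs.le h', sub_sub_cancel, mul_div_cancel₀ _ hs.ne']
  · rw [inverseBranch, tentMap_of_le hs.le h, mul_div_cancel₀ _ hs.ne']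

theorem inverseBranch_lt_critPt_iff (hs : 0 < s) (hy : y ≤ s / 2) {b : Bool}
    (hne : inverseBranch s b y ≠ critPt) : inverseBranch s b y < critPt ↔ b = true := by
  have h := div_le_critPt hs hy
  cases b
  · simp only [inverseBranch, Bool.false_eq_true, iff_false, not_lt, critPt] at *
    linarith
  · exact iff_of_true (lt_of_le_of_ne h hne) rfl

theorem inverseBranch_true_mem_iff (hs : 1 ≤ s) (hy : y ∈ tentCore s) :
    inverseBranch s true y ∈ tentCore s ↔ (tentMap s)^[3] critPt ≤ y := by
  have hs₀ : 0 < s := by linarith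
  have hcore := tentCore_eq hs
  have hle : y / s ≤ s / 2 :=
    (div_le_critPt hs₀ (hcore ▸ hy).2).trans (hcore ▸ critPt_mem_tentCore hs).2
  rw [iterate_three_critPt hs, hcore, inverseBranch, mem_Icc, and_iff_left hle, le_div_iff₀' hs₀]

theorem inverseBranch_false_mem (hs : 1 ≤ s) (hy : y ∈ tentCore s) :
    inverseBranch s false y ∈ tentCore s := by
  have hs₀ : 0 < s := by linarith
  have hcrit := (critPt_mem_tentCore hs).1
  rw [tentCore_eq hs] at hy
  have h₁ : y / s ≤ critPt := div_le_critPt hs₀ hy.2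
  have h₂ : 1 - s / 2 ≤ y / s := (le_div_iff₀' hs₀).2 hy.1
  have h₃ : critPt = 1 - critPt := by norm_num [critPt]
  rw [inverseBranch]
  exact ⟨by linarith, by rw [tentMap_critPt hs₀.le]; linarith⟩

theorem continuous_branchPath (s : ℝ) (k : ℕ) :
    Continuous fun p : (ℕ → Bool) × ℝ => branchPath s p.1 p.2 k := by
  induction k with
  | zero => exact continuous_snd
  | succ k ih =>
    have hbranch : Continuous fun q : Bool × ℝ => inverseBranch s q.1 q.2 := by
      rw [continuous_prod_of_discrete_left]
      rintro (_ | _)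
      · exact continuous_const.sub (continuous_id.div_const s)
      · exact continuous_id.div_const s
    exact hbranch.comp (((continuous_apply k).comp continuous_fst).prodMk ih)

theorem isClosed_admissibleItineraries (s y : ℝ) : IsClosed (admissibleItineraries s y) := by
  simp only [admissibleItineraries, ofPred_forall]
  exact isClosed_iInter fun k => isClosed_Icc.preimage
    ((continuous_branchPath s k).comp (Continuous.prodMk_left y))

theorem iterate_branchPath (hs : 1 ≤ s) {k : ℕ} (h : ∀ j < k, branchPath s e y j ∈ tentCore s) :
    (tentMap s)^[k] (branchPath s e y k) = y := by
  induction k with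
  | zero => rfl
  | succ k ih =>
    have hk := h k (Nat.lt_succ_self k)
    rw [tentCore_eq hs] at hk
    rw [Function.iterate_succ_apply, branchPath, tentMap_inverseBranch (by linarith) hk.2]
    exact ih fun j hj => h j (hj.trans (Nat.lt_succ_self k))

theorem branchPath_mem_coreInverseLimit (hs : 1 ≤ s) (he : e ∈ admissibleItineraries s y) :
    branchPath s e y ∈ coreInverseLimit s := fun k => by
  have hk := he k
  rw [tentCore_eq hs] at hk
  exact ⟨he k, tentMap_inverseBranch (by linarith) hk.2 _⟩

theorem branchPath_itinerary (hs : 0 < s) (hx : x ∈ coreInverseLimit s) :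
    branchPath s (itinerary x) (x 0) = x := by
  ext k
  induction k with
  | zero => rfl
  | succ k ih => rw [branchPath, ih, ← (hx k).2, itinerary, inverseBranch_tentMap hs]

theorem itinerary_mem_admissibleItineraries (hs : 0 < s) (hx : x ∈ coreInverseLimit s) :
    itinerary x ∈ admissibleItineraries s (x 0) := fun k => by
  rw [branchPath_itinerary hs hx]
  exact (hx k).1

theorem apply_ne_critPt (hx : x ∈ coreInverseLimit s) (h : ∀ n, (tentMap s)^[n] critPt ≠ x 0)
    (k : ℕ) : x k ≠ critPt := fun hk =>
  h k (hk ▸ backwardOrbits.iterate_apply_add hx k 0)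

theorem itinerary_branchPath (hs : 1 ≤ s) (he : e ∈ admissibleItineraries s y)
    (h : ∀ n, (tentMap s)^[n] critPt ≠ y) : itinerary (branchPath s e y) = e := by
  funext k
  have hk := he k
  rw [tentCore_eq hs] at hk
  have hne := apply_ne_critPt (branchPath_mem_coreInverseLimit hs he) h (k + 1)
  rw [branchPath] at hne
  simp only [itinerary, branchPath, inverseBranch_lt_critPt_iff (by linarith) hk.2 hne,
    Bool.decide_eq_true]

theorem continuousAt_itinerary (h : ∀ k, x k ≠ critPt) : ContinuousAt itinerary x := by
  refine continuousAt_pi.2 fun k => ?_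
  refine (continuousAt_const (y := itinerary x k)).congr ?_
  have hk : Tendsto (fun z : ℕ → ℝ => z (k + 1)) (𝓝 x) (𝓝 (x (k + 1))) :=
    (continuous_apply _).continuousAt
  rcases (h (k + 1)).lt_or_gt with hlt | hgt
  · filter_upwards [hk.eventually_lt_const hlt] with z hz
    simp only [itinerary, hlt, hz]
  · filter_upwards [hk.eventually_const_lt hgt] with z hz
    simp only [itinerary, hgt.not_gt, hz.not_gt]

variable {V : Set ℝ}

theorem admissibleItineraries_subset (hs : 1 ≤ s) (hV : V.OrdConnected) (hVK : V ⊆ tentCore s)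
    (hVc : ∀ n, (tentMap s)^[n] critPt ∉ V) (hy : y ∈ V) {t : ℝ} (ht : t ∈ V) :
    admissibleItineraries s y ⊆ admissibleItineraries s t := by
  intro e he k
  induction k using Nat.strong_induction_on generalizing t with
  | _ k ih =>
    rcases k with _ | k
    · exact hVK ht
    have hek := he (k + 1)
    rw [branchPath] at hek ⊢
    cases hb : e k
    · exact inverseBranch_false_mem hs (ih k k.lt_succ_self ht)
    · rw [hb, inverseBranch_true_mem_iff hs (he k)] at hek
      rw [inverseBranch_true_mem_iff hs (ih k k.lt_succ_self ht)]
      -- Otherwise the path of some point of `V` passes through `T³ c`, so `V` meets its orbit.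
      by_contra! hlt
      have hcont : Continuous fun r => branchPath s e r k :=
        (continuous_branchPath s k).comp (Continuous.prodMk_right e)
      obtain ⟨r, hr, hrk : branchPath s e r k = (tentMap s)^[3] critPt⟩ :=
        intermediate_value_uIcc hcont.continuousOn (mem_uIcc.2 (.inl ⟨hlt.le, hek⟩))
      have hrV : r ∈ V := hV.uIcc_subset ht hy hr
      refine hVc (k + 3) ?_
      rwa [Function.iterate_add_apply, ← hrk,
        iterate_branchPath hs fun j hj => ih j (hj.trans k.lt_succ_self) hrV]

theorem nonempty_homeomorph_admissibleItineraries_prod (hs : 1 ≤ s) (hV : V.OrdConnected)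
    (hVK : V ⊆ tentCore s) (hVc : ∀ n, (tentMap s)^[n] critPt ∉ V) (hy : y ∈ V) :
    Nonempty ({x : coreInverseLimit s | x.1 0 ∈ V} ≃ₜ admissibleItineraries s y × V) := by
  have hs₀ : 0 < s := by linarith
  have hne {t : ℝ} (ht : t ∈ V) (n : ℕ) : (tentMap s)^[n] critPt ≠ t := fun h => hVc n (h ▸ ht)
  have hadm {t : ℝ} (ht : t ∈ V) : admissibleItineraries s t = admissibleItineraries s y :=
    (admissibleItineraries_subset hs hV hVK hVc ht hy).antisymm
      (admissibleItineraries_subset hs hV hVK hVc hy ht)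
  have hmem (p : admissibleItineraries s y × V) : p.1.1 ∈ admissibleItineraries s p.2 := by
    rw [hadm p.2.2]
    exact p.1.2
  exact ⟨{
    toFun x := (⟨itinerary x.1.1, hadm x.2 ▸ itinerary_mem_admissibleItineraries hs₀ x.1.2⟩,
      ⟨x.1.1 0, x.2⟩)
    invFun p := ⟨⟨branchPath s p.1 p.2, branchPath_mem_coreInverseLimit hs (hmem p)⟩, p.2.2⟩
    left_inv x := Subtype.ext (Subtype.ext (branchPath_itinerary hs₀ x.1.2))
    right_inv p := Prod.ext (Subtype.ext (itinerary_branchPath hs (hmem p) (hne p.2.2))) rfl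
    continuous_toFun := by
      have hval : Continuous fun x : {x : coreInverseLimit s | x.1 0 ∈ V} => x.1.1 := by fun_prop
      have hitin : Continuous fun x : {x : coreInverseLimit s | x.1 0 ∈ V} => itinerary x.1.1 :=
        continuous_iff_continuousAt.2 fun x =>
          (continuousAt_itinerary (apply_ne_critPt x.1.2 (hne x.2))).tendsto.comp (hval.tendsto x)
      exact (hitin.subtype_mk _).prodMk (((continuous_apply 0).comp hval).subtype_mk _)
    continuous_invFun := by
      have hpath : Continuous fun p : admissibleItineraries s y × V => branchPath s p.1 p.2 :=
        continuous_pi fun k => (continuous_branchPath s k).comp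
          (continuous_subtype_val.prodMap continuous_subtype_val)
      exact (hpath.subtype_mk _).subtype_mk _ }⟩

theorem exists_nhds_homeomorph_admissibleItineraries (hs₁ : 1 ≤ s) (hs₂ : s ≤ 2)
    {x : coreInverseLimit s} {i : ℕ} (hx : x.1 i ∉ orbitClosure (tentMap s) critPt) :
    ∃ U ∈ 𝓝 x, Nonempty (U ≃ₜ admissibleItineraries s (x.1 i) × Ioo (0 : ℝ) 1) := by
  obtain ⟨a, b, hxV, hdisj⟩ :=
    mem_nhds_iff_exists_Ioo_subset.1 (isClosed_closure.isOpen_compl.mem_nhds hx)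
  have hVc (n : ℕ) : (tentMap s)^[n] critPt ∉ Ioo a b := fun h =>
    hdisj h (iterate_mem_orbitClosure _ _ n)
  have hVK : Ioo a b ⊆ tentCore s := by
    obtain ⟨h₂, h₁⟩ := (x.2 i).1
    intro t ht
    exact ⟨le_of_not_ge fun h => hVc 2 (ordConnected_Ioo.out ht hxV ⟨h, h₂⟩),
      le_of_not_ge fun h => hVc 1 (ordConnected_Ioo.out hxV ht ⟨h₁, h⟩)⟩
  obtain ⟨φ⟩ := nonempty_homeomorph_admissibleItineraries_prod hs₁ ordConnected_Ioo hVK hVc hxV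
  obtain ⟨ψ⟩ := nonempty_homeomorph_Ioo (hxV.1.trans hxV.2)
  let σ := backwardOrbits.shift (continuous_tentMap s) (mapsTo_tentMap_tentCore hs₁ hs₂) i
  exact ⟨{z | z.1 i ∈ Ioo a b},
    (isOpen_Ioo.preimage (backwardOrbits.continuous_apply i)).mem_nhds hxV,
    ⟨(σ.sets rfl).trans (φ.trans ((Homeomorph.refl _).prodCongr ψ))⟩⟩

theorem mem_admissibleItineraries_iff (hs : 1 ≤ s) (hy : y ∈ tentCore s) :
    e ∈ admissibleItineraries s y ↔
      ∀ k, e k = true → (tentMap s)^[3] critPt ≤ branchPath s e y k := by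
  constructor
  · intro h k hk
    have hmem := h (k + 1)
    rwa [branchPath, hk, inverseBranch_true_mem_iff hs (h k)] at hmem
  · intro h k
    induction k with
    | zero => exact hy
    | succ k ih =>
      rw [branchPath]
      cases hb : e k
      · exact inverseBranch_false_mem hs ih
      · exact (inverseBranch_true_mem_iff hs ih).2 (h k hb)

theorem frequently_iterate_three_critPt_le_branchPath (hs : √2 < s)
    (he : e ∈ admissibleItineraries s y) :
    ∃ᶠ k in atTop, (tentMap s)^[3] critPt ≤ branchPath s e y k := by
  have hs₁ : 1 < s := Real.one_lt_sqrt_two.trans hs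
  have hs₂ : 2 < s ^ 2 := (Real.sqrt_lt' (by linarith)).1 hs
  rw [frequently_atTop]
  intro n
  by_cases hn : (tentMap s)^[3] critPt ≤ branchPath s e y n
  · exact ⟨n, le_rfl, hn⟩
  · refine ⟨n + 1, n.le_succ, ?_⟩
    have hen : e n = false := by
      by_contra h
      exact hn ((mem_admissibleItineraries_iff hs₁.le (he 0)).1 he n (by simpa using h))
    rw [iterate_three_critPt hs₁.le] at hn ⊢
    rw [branchPath, hen, inverseBranch]
    have hdiv : branchPath s e y n / s ≤ s * (1 - s / 2) := by
      rw [div_le_iff₀' (by linarith)]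
      exact (not_le.1 hn).le
    nlinarith [mul_pos (sub_pos.2 hs₁) (sub_pos.2 hs₂)]

open PiNat

theorem branchPath_eq_of_mem_cylinder {e' : ℕ → Bool} {k : ℕ} (h : e' ∈ cylinder e k) :
    branchPath s e' y k = branchPath s e y k := by
  induction k with
  | zero => rfl
  | succ k ih => rw [branchPath, branchPath, h k k.lt_succ_self, ih (cylinder_anti e k.le_succ h)]

theorem exists_mem_admissibleItineraries_ne (hs : 1 ≤ s) (he : e ∈ admissibleItineraries s y)
    {k : ℕ} (hk : (tentMap s)^[3] critPt ≤ branchPath s e y k) :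
    ∃ e' ∈ admissibleItineraries s y, e' ∈ cylinder e k ∧ e' ≠ e := by
  let e' (j : ℕ) : Bool := if k < j then false else Function.update e k (!e k) j
  have hcyl : e' ∈ cylinder e k := fun j hj => by
    simp only [e', hj.not_gt, hj.ne, if_false, ne_eq, not_false_eq_true, Function.update_of_ne]
  refine ⟨e', (mem_admissibleItineraries_iff hs (he 0)).2 fun j hj => ?_, hcyl, fun h => ?_⟩
  · rcases lt_trichotomy j k with hjk | rfl | hkj
    · rw [branchPath_eq_of_mem_cylinder (cylinder_anti e hjk.le hcyl)]
      exact (mem_admissibleItineraries_iff hs (he 0)).1 he j (hcyl j hjk ▸ hj)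
    · rwa [branchPath_eq_of_mem_cylinder hcyl]
    · simp [e', hkj] at hj
  · simpa [e'] using congrFun h k

theorem perfect_admissibleItineraries (hs : √2 < s) (y : ℝ) :
    Perfect (admissibleItineraries s y) := by
  refine ⟨isClosed_admissibleItineraries s y, preperfect_iff_nhds.2 fun e he U hU => ?_⟩
  obtain ⟨_, ⟨a, n, rfl⟩, hea, haU⟩ := (isTopologicalBasis_cylinders _).mem_nhds_iff.1 hU
  rw [← mem_cylinder_iff_eq.1 hea] at haU
  obtain ⟨k, hnk, hk⟩ :=
    frequently_atTop.1 (frequently_iterate_three_critPt_le_branchPath hs he) n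
  obtain ⟨e', he', hcyl, hne⟩ :=
    exists_mem_admissibleItineraries_ne (Real.one_lt_sqrt_two.trans hs).le he hk
  exact ⟨e', ⟨haU (cylinder_anti e hnk hcyl), he'⟩, hne⟩

theorem admissibleItineraries_nonempty (hs : 1 ≤ s) (hy : y ∈ tentCore s) :
    (admissibleItineraries s y).Nonempty :=
  ⟨fun _ => false, (mem_admissibleItineraries_iff hs hy).2 fun _ h => absurd h Bool.false_ne_true⟩

end Itineraries

section FoldingPoints

variable {s : ℝ} {x : coreInverseLimit s}

theorem mem_orbitClosure_of_mem_wideFoldingPoints (hs₁ : 1 ≤ s) (hs₂ : s ≤ 2)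
    (hx : x ∈ wideFoldingPoints (coreInverseLimit s)) (i : ℕ) :
    x.1 i ∈ orbitClosure (tentMap s) critPt := by
  by_contra hi
  obtain ⟨U, hU, h⟩ := exists_nhds_homeomorph_admissibleItineraries hs₁ hs₂ hi
  have hcompact := (isClosed_admissibleItineraries s (x.1 i)).isCompact
  exact hx ⟨U, hU, _, _, isCompact_iff_compactSpace.1 hcompact, inferInstance, inferInstance, h⟩

theorem mem_orbitClosure_of_mem_foldingPoints (hs : √2 < s) (hs₂ : s ≤ 2)
    (hx : x ∈ foldingPoints (coreInverseLimit s)) (i : ℕ) :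
    x.1 i ∈ orbitClosure (tentMap s) critPt := by
  by_contra hi
  have hs₁ : 1 ≤ s := (Real.one_lt_sqrt_two.trans hs).le
  obtain ⟨U, hU, ⟨φ⟩⟩ := exists_nhds_homeomorph_admissibleItineraries hs₁ hs₂ hi
  obtain ⟨ψ⟩ := nonempty_homeomorph_nat_bool_of_perfect (perfect_admissibleItineraries hs (x.1 i))
    (admissibleItineraries_nonempty hs₁ (x.2 i).1)
  exact hx ⟨U, hU, ⟨φ.trans (ψ.prodCongr (.refl _))⟩⟩

end FoldingPoints

theorem proposition4p5 (s : ℝ) (hs₁ : 1 < s) (hs₂ : s ≤ 2)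
    (hinf : (forwardOrbit (tentMap s) critPt).Infinite)
    (hrec : IsRecurrentPt (tentMap s) critPt) :
    ¬ (endpoints (coreInverseLimit s)).Countable ∧
    Preperfect (endpoints (coreInverseLimit s)) ∧
    (endpoints (coreInverseLimit s) ⊆ wideFoldingPoints (coreInverseLimit s) ∧
      wideFoldingPoints (coreInverseLimit s) ⊆ closure (endpoints (coreInverseLimit s))) ∧
    (Real.sqrt 2 < s →
      endpoints (coreInverseLimit s) ⊆ foldingPoints (coreInverseLimit s) ∧
      foldingPoints (coreInverseLimit s) ⊆ closure (endpoints (coreInverseLimit s))) := by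
  have hdiff {C : Set (coreInverseLimit s)} (hC : C.Countable) {x : coreInverseLimit s} :=
    mem_closure_endpoints_coreInverseLimit_diff (x := x) hs₁.le hs₂ hinf hrec hC
  have hdense {x : coreInverseLimit s} (hx : ∀ n, x.1 n ∈ orbitClosure (tentMap s) critPt) :
      x ∈ closure (endpoints (coreInverseLimit s)) :=
    closure_mono sdiff_subset (hdiff countable_empty hx)
  have hEF : endpoints (coreInverseLimit s) ⊆ wideFoldingPoints (coreInverseLimit s) :=
    endpoints_subset_wideFoldingPoints
  have hFL {x} := mem_orbitClosure_of_mem_wideFoldingPoints (x := x) hs₁.le hs₂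
  refine ⟨fun hE => ?_, fun x hx => ?_, ⟨hEF, fun x hx => hdense (hFL hx)⟩, fun hs => ?_⟩
  · have hf := continuous_tentMap s
    obtain ⟨x, -⟩ := backwardOrbits.exists_apply_eq (mapsTo_orbitClosure hf)
      (hrec.surjOn_orbitClosure hf (isCompact_orbitClosure_tentMap hs₁.le hs₂))
      (iterate_mem_orbitClosure (tentMap s) critPt 0) 0
    have hx := backwardOrbits.mono (orbitClosure_subset_tentCore hs₁.le hs₂) x.2
    simpa using hdiff hE (x := ⟨x, hx⟩) fun n => (x.2 n).1
  · rw [accPt_principal_iff_clusterPt, ← mem_closure_iff_clusterPt]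
    exact hdiff (countable_singleton x) (hFL (hEF hx))
  · exact ⟨hEF.trans wideFoldingPoints_subset_foldingPoints,
      fun x hx => hdense (mem_orbitClosure_of_mem_foldingPoints hs hs₂ hx)⟩
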